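/- **Setting.** Let $m\ge 0$, let $n_1,\dots,n_m$ be positive integers, $V=\bigoplus_{k=1}^m\mathbb C^{n_k}$ with coordinates $x_{ki}$ ($1\le k\le m$, $1\le i\le n_k$), and let $G=S_{n_1}\times\dots\times S_{n_m}$ act on $V$ by permuting coordinates within each block. We work in one of two categories: the complex-analytic one, where $\mathcal O$ is the sheaf of holomorphic functions and $\mathcal M(V)$ the algebra of meromorphic functions on $V$, or the algebraic one, where $\mathcal O$ is the sheaf of regular functions (so its global sections are the polynomials and $\mathcal O_v$ is the local ring at $v$) and $\mathcal M(V)$ is the field of rational functions; "holomorphic in $V$" then means polynomial. Let $\mathcal S(V)$ be the skew group ring of finite sums $\sum_{\xi\in V} f_\xi\phi_\xi$, $f_\xi\in\mathcal M(V)$, with $f\phi_\xi\circ f'\phi_\eta=f\,\phi_\xi(f')\,\phi_{\xi+\eta}$, $\phi_\xi(f')(x)=f'(x-\xi)$. The group $G$ acts on it by $g\cdot(f\phi_\xi)=(g\cdot f)\phi_{g\xi}$, $(g\cdot f)(v)=f(g^{-1}v)$; $\mathcal S(V)^G$ is the subalgebra of invariants. An element $f\phi_\xi$ sends a germ $F$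 at $v$ to the germ of $f\cdot(F\circ(x\mapsto x-\xi))$ at $v+\xi$; in this way $\mathcal S(V)$ acts on $\bigoplus_{v\in V}\mathcal M_v$, where $\mathcal M_v$ is the algebra of germs of meromorphic (rational) functions at $v$. Let $\mathfrak O^G$ be the space of $G$-invariant elements of $\bigoplus_{v\in V}\mathcal O_v$. For $a\in\mathbb C$ let $\xi^a_k\in V$ be the vector with $x_{k1}=a$ and all other coordinates $0$. Put $\Delta=\prod_k\prod_{i<j}(x_{ki}-x_{kj})$. For a character $\chi:G\to\mathbb C^\times$ put $d_\chi=\prod_k\prod_{i<j}(x_{ki}-x_{kj})^{a_{kij}}$, where $a_{kij}\ge 0$ is the least integer with $\chi(\sigma_{kij})=(-1)^{a_{kij}}$ and $\sigma_{kij}\in G$ is the transposition of the coordinates $x_{ki},x_{kj}$. A *rational Galois order* is a subalgebra of $\mathcal S(V)^G$ that contains the algebra $H^0(V,\mathcal O)^G$ of global $G$-invariant holomorphic functions and is generated over it by a finite set of elements $X\in\mathcal S(V)^G$ such that for each such $X$ there is a character $\chi$ of $G$ for which all coefficients of $d_\chi X$ are holomorphic in $V$; the elements $X$ are its *generators*.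 **Theorem.** Let $f_1,\dots,f_p\in\mathcal M(V)$, $i_1,\dots,i_p\in\{1,\dots,m\}$, $a_1,\dots,a_p\in\mathbb C$, and assume that $$A=\sum_{s=1}^p\sum_{g\in G}g\cdot\bigl(f_s\,\phi_{\xi^{a_s}_{i_s}}\bigr)\in\mathcal S(V)^G$$ preserves $\mathfrak O^G$, i.e. $A(\mathfrak O^G)\subset\mathfrak O^G$. Then: 1. $A$ is a generator of a rational Galois order. 2. For every $\xi\in V$ the coefficient $A_\xi$ of $\phi_\xi$ in $A=\sum_\xi A_\xi\phi_\xi$ has at most simple poles along the walls $x_{ki}=x_{kj}$ and no other poles: $A_\xi\,\Delta$ is holomorphic in $V$. 3. If, for some $s$, the function $f_s$ is invariant under the stabilizer of $\xi^{a_s}_{i_s}$ in $G$, and $\xi^{a_t}_{i_t}\ne\xi^{a_s}_{i_s}$ for all $t\neq s$, then $f_s\,\Delta$ is holomorphic in $V$. -/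

import Mathlib

open Filter Topology

noncomputable section

set_option linter.unusedSectionVars false

namespace OGZ

/-! ### Meromorphic and rational functions on `ℂ^ι` -/

/-- The two categories: complex-analytic (holomorphic and meromorphic functions) and
algebraic (regular and rational functions). -/
inductive Setting
  | analytic
  | algebraic

section Functions

/-- The filter of the sets that contain a dense open set. A germ along this filter is a
function up to equality on a dense open set. -/
def generic (X : Type*) [TopologicalSpace X] : Filter X where
  sets := {s | Dense (interior s)}
  univ_sets := by simp
  sets_of_superset := fun hs hst => hs.mono (interior_mono hst)
  inter_sets := fun {s t} hs ht => by
    change Dense (interior (s ∩ t))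
    rw [interior_inter]
    exact Dense.inter_of_isOpen_left hs ht isOpen_interior

/-- The generic filter localized at the point `v`. -/
def genericAt {X : Type*} [TopologicalSpace X] (v : X) : Filter X := 𝓝 v ⊓ generic X

theorem tendsto_generic {X : Type*} [TopologicalSpace X] (T : X ≃ₜ X) :
    Tendsto T (generic X) (generic X) := by
  intro s hs
  change Dense (interior (T ⁻¹' s))
  rw [← T.preimage_interior]
  exact Dense.preimage hs T.isOpenMap

theorem tendsto_genericAt {X : Type*} [TopologicalSpace X] (T : X ≃ₜ X) (v : X) :
    Tendsto T (genericAt v) (genericAt (T v)) :=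
  (T.continuous.tendsto v).inf (tendsto_generic T)

instance germAlgebra {X : Type*} (l : Filter X) : Algebra ℂ (Germ l ℂ) :=
  Algebra.ofModule
    (fun r x y => by
      induction x, y using Germ.inductionOn₂ with
      | h f g => exact congrArg (fun h : X → ℂ => (h : Germ l ℂ)) (smul_mul_assoc r f g))
    (fun r x y => by
      induction x, y using Germ.inductionOn₂ with
      | h f g => exact congrArg (fun h : X → ℂ => (h : Germ l ℂ)) (mul_smul_comm r f g))

variable {ι : Type*} [Fintype ι]

/-- `f` is a global section of the structure sheaf of `ℂ^ι`: an entire function in the analytic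
setting, a polynomial function in the algebraic one. -/
def IsRegular (c : Setting) (f : (ι → ℂ) → ℂ) : Prop :=
  match c with
  | .analytic => ∀ v, AnalyticAt ℂ f v
  | .algebraic => ∃ P : MvPolynomial ι ℂ, ∀ x, f x = MvPolynomial.eval x P

/-- The germ of `f` at `v` belongs to the stalk of the structure sheaf: `f` is analytic at `v`,
respectively it is, near `v`, a quotient of polynomials whose denominator is not `0` at `v`. -/
def IsRegularAt (c : Setting) (f : (ι → ℂ) → ℂ) (v : ι → ℂ) : Prop :=
  match c with
  | .analytic => AnalyticAt ℂ f v
  | .algebraic => ∃ P Q : MvPolynomial ι ℂ, MvPolynomial.eval v Q ≠ 0 ∧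
      ∀ᶠ x in 𝓝 v, f x * MvPolynomial.eval x Q = MvPolynomial.eval x P

/-- `f` represents a meromorphic (respectively rational) function on `ℂ^ι`. The values on a
nowhere dense set are irrelevant. Meromorphic: near every point, a quotient `p / q` of
analytic functions with `q` not identically zero near that point. Rational: a
quotient of polynomials. -/
def IsMeromorphic (c : Setting) (f : (ι → ℂ) → ℂ) : Prop :=
  match c with
  | .analytic => ∀ v, ∃ p q : (ι → ℂ) → ℂ, AnalyticAt ℂ p v ∧ AnalyticAt ℂ q v ∧
      (¬ ∀ᶠ x in 𝓝 v, q x = 0) ∧ ∀ᶠ x in genericAt v, f x * q x = p x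
  | .algebraic => ∃ P Q : MvPolynomial ι ℂ, Q ≠ 0 ∧
      ∀ᶠ x in generic (ι → ℂ), f x * MvPolynomial.eval x Q = MvPolynomial.eval x P

theorem not_eventually_mul_eq_zero {p q : (ι → ℂ) → ℂ} {v : ι → ℂ} (hp : AnalyticAt ℂ p v)
    (hq : AnalyticAt ℂ q v) (hp0 : ¬ ∀ᶠ x in 𝓝 v, p x = 0) (hq0 : ¬ ∀ᶠ x in 𝓝 v, q x = 0) :
    ¬ ∀ᶠ x in 𝓝 v, p x * q x = 0 := by
  intro h
  obtain ⟨r, hr, hball⟩ := Metric.eventually_nhds_iff_ball.1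
    ((hp.eventually_analyticAt.and hq.eventually_analyticAt).and h)
  refine hq0 ?_
  have hfreq : ∃ y ∈ Metric.ball v r, p y ≠ 0 := by
    by_contra hcon
    push Not at hcon
    exact hp0 (Filter.mem_of_superset (Metric.ball_mem_nhds v hr) hcon)
  obtain ⟨y, hy, hpy⟩ := hfreq
  have hqy : q =ᶠ[𝓝 y] 0 := by
    filter_upwards [(hball y hy).1.1.continuousAt.eventually_ne hpy,
      Metric.isOpen_ball.mem_nhds hy] with x hx hxb
    exact (mul_eq_zero.1 (hball x hxb).2).resolve_left hx
  have hon : AnalyticOnNhd ℂ q (Metric.ball v r) := fun x hx => (hball x hx).1.2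
  have := hon.eqOn_zero_of_preconnected_of_eventuallyEq_zero
    (convex_ball v r).isPreconnected hy hqy
  exact Filter.mem_of_superset (Metric.ball_mem_nhds v hr) this

theorem genericAt_le_nhds (v : ι → ℂ) : genericAt v ≤ 𝓝 v := inf_le_left

theorem genericAt_le_generic (v : ι → ℂ) : genericAt v ≤ generic (ι → ℂ) := inf_le_right

theorem analyticAt_eval (P : MvPolynomial ι ℂ) (v : ι → ℂ) :
    AnalyticAt ℂ (fun x => MvPolynomial.eval x P) v :=
  AnalyticOnNhd.eval_mvPolynomial P v (Set.mem_univ v)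

theorem IsRegular.isMeromorphic {c : Setting} {f : (ι → ℂ) → ℂ} (hf : IsRegular c f) :
    IsMeromorphic c f := by
  cases c with
  | analytic =>
    intro v
    refine ⟨f, fun _ => 1, hf v, analyticAt_const, ?_, by simp⟩
    intro h
    simpa using h.self_of_nhds
  | algebraic =>
    obtain ⟨P, hP⟩ := hf
    exact ⟨P, 1, one_ne_zero, by simp [hP]⟩

theorem isRegular_eval (c : Setting) (P : MvPolynomial ι ℂ) :
    IsRegular c (fun x => MvPolynomial.eval x P) := by
  cases c with
  | analytic => exact fun v => analyticAt_eval P v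
  | algebraic => exact ⟨P, fun _ => rfl⟩

theorem IsRegular.add {c : Setting} {f g : (ι → ℂ) → ℂ} (hf : IsRegular c f)
    (hg : IsRegular c g) : IsRegular c (f + g) := by
  cases c with
  | analytic => exact fun v => (hf v).add (hg v)
  | algebraic =>
    obtain ⟨P, hP⟩ := hf
    obtain ⟨Q, hQ⟩ := hg
    exact ⟨P + Q, fun x => by simp [hP, hQ]⟩

theorem IsRegular.mul {c : Setting} {f g : (ι → ℂ) → ℂ} (hf : IsRegular c f)
    (hg : IsRegular c g) : IsRegular c (f * g) := by
  cases c with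
  | analytic => exact fun v => (hf v).mul (hg v)
  | algebraic =>
    obtain ⟨P, hP⟩ := hf
    obtain ⟨Q, hQ⟩ := hg
    exact ⟨P * Q, fun x => by simp [hP, hQ]⟩

theorem IsMeromorphic.add {c : Setting} {f g : (ι → ℂ) → ℂ} (hf : IsMeromorphic c f)
    (hg : IsMeromorphic c g) : IsMeromorphic c (f + g) := by
  cases c with
  | analytic =>
    intro v
    obtain ⟨p, q, hp, hq, hq0, h⟩ := hf v
    obtain ⟨p', q', hp', hq', hq0', h'⟩ := hg v
    refine ⟨p * q' + p' * q, q * q', (hp.mul hq').add (hp'.mul hq), hq.mul hq',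
      not_eventually_mul_eq_zero hq hq' hq0 hq0', ?_⟩
    filter_upwards [h, h'] with x hx hx'
    simp only [Pi.add_apply, Pi.mul_apply, ← hx, ← hx']
    ring
  | algebraic =>
    obtain ⟨P, Q, hQ, h⟩ := hf
    obtain ⟨P', Q', hQ', h'⟩ := hg
    refine ⟨P * Q' + P' * Q, Q * Q', mul_ne_zero hQ hQ', ?_⟩
    filter_upwards [h, h'] with x hx hx'
    simp only [Pi.add_apply, map_add, map_mul, ← hx, ← hx']
    ring

theorem IsMeromorphic.mul {c : Setting} {f g : (ι → ℂ) → ℂ} (hf : IsMeromorphic c f)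
    (hg : IsMeromorphic c g) : IsMeromorphic c (f * g) := by
  cases c with
  | analytic =>
    intro v
    obtain ⟨p, q, hp, hq, hq0, h⟩ := hf v
    obtain ⟨p', q', hp', hq', hq0', h'⟩ := hg v
    refine ⟨p * p', q * q', hp.mul hp', hq.mul hq',
      not_eventually_mul_eq_zero hq hq' hq0 hq0', ?_⟩
    filter_upwards [h, h'] with x hx hx'
    simp only [Pi.mul_apply, ← hx, ← hx']
    ring
  | algebraic =>
    obtain ⟨P, Q, hQ, h⟩ := hf
    obtain ⟨P', Q', hQ', h'⟩ := hg
    refine ⟨P * P', Q * Q', mul_ne_zero hQ hQ', ?_⟩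
    filter_upwards [h, h'] with x hx hx'
    simp only [Pi.mul_apply, map_mul, ← hx, ← hx']
    ring

/-- The polynomial map condition for a self-map of `ℂ^ι`. -/
def IsPolyMap (T : (ι → ℂ) → (ι → ℂ)) : Prop :=
  ∃ P : ι → MvPolynomial ι ℂ, ∀ x i, T x i = MvPolynomial.eval x (P i)

theorem IsPolyMap.eval_comp {T : (ι → ℂ) → (ι → ℂ)} {P : ι → MvPolynomial ι ℂ}
    (hP : ∀ x i, T x i = MvPolynomial.eval x (P i)) (Q : MvPolynomial ι ℂ) (x : ι → ℂ) :
    MvPolynomial.eval (T x) Q = MvPolynomial.eval x (MvPolynomial.bind₁ P Q) := by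
  have hT : T x = fun i => MvPolynomial.eval x (P i) := funext (hP x)
  rw [hT]
  induction Q using MvPolynomial.induction_on with
  | C a => simp
  | add p q hp hq => simp [hp, hq]
  | mul_X p i hp => simp [hp]

theorem IsPolyMap.analyticAt {T : (ι → ℂ) → (ι → ℂ)} (hT : IsPolyMap T) (v : ι → ℂ) :
    AnalyticAt ℂ T v := by
  obtain ⟨P, hP⟩ := hT
  rw [analyticAt_pi_iff]
  intro i
  simpa only [← hP] using analyticAt_eval (P i) v

theorem IsRegular.comp {c : Setting} {f : (ι → ℂ) → ℂ} (hf : IsRegular c f)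
    {T : (ι → ℂ) → (ι → ℂ)} (hT : IsPolyMap T) : IsRegular c (f ∘ T) := by
  cases c with
  | analytic => exact fun v => (hf (T v)).comp (hT.analyticAt v)
  | algebraic =>
    obtain ⟨P, hP⟩ := hf
    obtain ⟨Q, hQ⟩ := hT
    exact ⟨MvPolynomial.bind₁ Q P, fun x => by
      rw [← IsPolyMap.eval_comp hQ, Function.comp_apply, hP]⟩

theorem IsMeromorphic.comp {c : Setting} {f : (ι → ℂ) → ℂ} (hf : IsMeromorphic c f)
    {T : (ι → ℂ) ≃ₜ (ι → ℂ)} (hT : IsPolyMap T) : IsMeromorphic c (f ∘ T) := by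
  cases c with
  | analytic =>
    intro v
    obtain ⟨p, q, hp, hq, hq0, h⟩ := hf (T v)
    refine ⟨p ∘ T, q ∘ T, hp.comp (hT.analyticAt v), hq.comp (hT.analyticAt v), ?_,
      (tendsto_genericAt T v).eventually h⟩
    intro h0
    apply hq0
    rw [← T.map_nhds_eq v, Filter.eventually_map]
    exact h0
  | algebraic =>
    obtain ⟨P, Q, hQ, h⟩ := hf
    obtain ⟨R, hR⟩ := hT
    refine ⟨MvPolynomial.bind₁ R P, MvPolynomial.bind₁ R Q, ?_, ?_⟩
    · intro h0
      apply hQ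
      apply MvPolynomial.funext
      intro x
      have := IsPolyMap.eval_comp hR Q (T.symm x)
      rw [h0, T.apply_symm_apply] at this
      simpa using this
    · filter_upwards [(tendsto_generic T).eventually h] with x hx
      rw [← IsPolyMap.eval_comp hR, ← IsPolyMap.eval_comp hR]
      exact hx

/-- The algebra of global meromorphic (respectively rational) functions on `ℂ^ι`. -/
def meroSubalgebra (c : Setting) (ι : Type*) [Fintype ι] :
    Subalgebra ℂ (Germ (generic (ι → ℂ)) ℂ) where
  carrier := {φ | ∃ f : (ι → ℂ) → ℂ, IsMeromorphic c f ∧ φ = f}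
  mul_mem' := by
    rintro _ _ ⟨f, hf, rfl⟩ ⟨g, hg, rfl⟩
    exact ⟨f * g, hf.mul hg, rfl⟩
  add_mem' := by
    rintro _ _ ⟨f, hf, rfl⟩ ⟨g, hg, rfl⟩
    exact ⟨f + g, hf.add hg, rfl⟩
  algebraMap_mem' := fun r => ⟨fun x => MvPolynomial.eval x (MvPolynomial.C r),
    (isRegular_eval c _).isMeromorphic, by
      rw [Algebra.algebraMap_eq_smul_one]
      refine congrArg (fun h : (ι → ℂ) → ℂ => (h : Germ (generic (ι → ℂ)) ℂ)) ?_
      funext x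
      simp⟩

/-- Meromorphic (respectively rational) functions on `ℂ^ι`. -/
abbrev Mero (c : Setting) (ι : Type*) [Fintype ι] : Type _ := meroSubalgebra c ι

/-- The algebra of global sections of the structure sheaf: those meromorphic (rational)
functions that are entire (polynomial). -/
def regularFunctions (c : Setting) (ι : Type*) [Fintype ι] : Subalgebra ℂ (Mero c ι) where
  carrier := {φ | ∃ f : (ι → ℂ) → ℂ, IsRegular c f ∧ (φ : Germ (generic (ι → ℂ)) ℂ) = f}
  mul_mem' := by
    rintro ⟨_, _⟩ ⟨_, _⟩ ⟨f, hf, rfl⟩ ⟨g, hg, rfl⟩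
    exact ⟨f * g, hf.mul hg, rfl⟩
  add_mem' := by
    rintro ⟨_, _⟩ ⟨_, _⟩ ⟨f, hf, rfl⟩ ⟨g, hg, rfl⟩
    exact ⟨f + g, hf.add hg, rfl⟩
  algebraMap_mem' := fun r => ⟨fun x => MvPolynomial.eval x (MvPolynomial.C r),
    isRegular_eval c _, by
      rw [Algebra.algebraMap_eq_smul_one]
      refine congrArg (fun h : (ι → ℂ) → ℂ => (h : Germ (generic (ι → ℂ)) ℂ)) ?_
      funext x
      simp⟩

/-- A polynomial, as a meromorphic (rational) function. -/
def ofPoly (c : Setting) (P : MvPolynomial ι ℂ) : Mero c ι :=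
  ⟨((fun x => MvPolynomial.eval x P : (ι → ℂ) → ℂ) : Germ (generic (ι → ℂ)) ℂ),
    _, (isRegular_eval c P).isMeromorphic, rfl⟩

/-- Pullback `f ↦ f ∘ T` of meromorphic (rational) functions. -/
def pull (c : Setting) (T : (ι → ℂ) ≃ₜ (ι → ℂ)) (hT : IsPolyMap T) :
    Mero c ι →ₐ[ℂ] Mero c ι where
  toFun φ := ⟨φ.1.compTendsto T (tendsto_generic T), by
    obtain ⟨_, f, hf, rfl⟩ := φ
    exact ⟨f ∘ T, hf.comp hT, rfl⟩⟩
  map_one' := rfl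
  map_zero' := rfl
  map_mul' := by
    rintro ⟨_, f, hf, rfl⟩ ⟨_, g, hg, rfl⟩
    rfl
  map_add' := by
    rintro ⟨_, f, hf, rfl⟩ ⟨_, g, hg, rfl⟩
    rfl
  commutes' := fun r => by
    apply Subtype.ext
    simp only [Algebra.algebraMap_eq_smul_one]
    rfl

/-- The translation `x ↦ x - ξ`. -/
def translation (ξ : ι → ℂ) : (ι → ℂ) ≃ₜ (ι → ℂ) := Homeomorph.subRight ξ

@[simp] theorem translation_apply (ξ x : ι → ℂ) : translation ξ x = x - ξ := rfl

theorem isPolyMap_translation (ξ : ι → ℂ) : IsPolyMap (translation ξ) :=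
  ⟨fun i => MvPolynomial.X i - MvPolynomial.C (ξ i), fun x i => by simp⟩

/-- The left translation action of the additive group `ℂ^ι` (written multiplicatively) on
meromorphic functions: `(ξ • f) x = f (x - ξ)`. -/
instance translationAction (c : Setting) :
    MulSemiringAction (Multiplicative (ι → ℂ)) (Mero c ι) where
  smul ξ φ := pull c (translation ξ.toAdd) (isPolyMap_translation _) φ
  one_smul := by
    rintro ⟨_, f, hf, rfl⟩
    refine Subtype.ext (congrArg (fun h : (ι → ℂ) → ℂ => (h : Germ (generic (ι → ℂ)) ℂ)) ?_)
    funext x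
    simp
  mul_smul := by
    rintro ξ η ⟨_, f, hf, rfl⟩
    refine Subtype.ext (congrArg (fun h : (ι → ℂ) → ℂ => (h : Germ (generic (ι → ℂ)) ℂ)) ?_)
    funext x
    simp [sub_sub]
  smul_zero ξ := map_zero (pull c _ _)
  smul_add ξ := map_add (pull c _ _)
  smul_one ξ := map_one (pull c _ _)
  smul_mul ξ := map_mul (pull c _ _)

instance translationAction_comm (c : Setting) :
    SMulCommClass (Multiplicative (ι → ℂ)) ℂ (Mero c ι) where
  smul_comm ξ r φ := map_smul (pull c (translation ξ.toAdd) (isPolyMap_translation _)) r φ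

/-- The germ at `v` of a meromorphic function. -/
def Mero.germAt {c : Setting} (φ : Mero c ι) (v : ι → ℂ) : Germ (genericAt v) ℂ :=
  φ.1.compTendsto id (tendsto_id'.2 (genericAt_le_generic v))

end Functions

/-! ### The skew group ring -/

section Skew

variable {m : ℕ}

/-- The index set of the coordinates `x_{ki}`, `1 ≤ k ≤ m`, `1 ≤ i ≤ n_k`. -/
abbrev Idx (n : Fin m → ℕ) : Type := Σ k : Fin m, Fin (n k)

/-- The vector space `V = ⨁_k ℂ^{n_k}`. -/
abbrev V (n : Fin m → ℕ) : Type := Idx n → ℂ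

/-- The group `G = S_{n_1} × ⋯ × S_{n_m}`. -/
abbrev G (n : Fin m → ℕ) : Type := ∀ k : Fin m, Equiv.Perm (Fin (n k))

/-- The action of `G` on `V` by permutations of coordinates,
`(g • v)_{ki} = v_{k, g_k⁻¹ i}`. -/
def perm {n : Fin m → ℕ} (g : G n) : V n ≃ₜ V n where
  toFun v x := v ⟨x.1, (g x.1)⁻¹ x.2⟩
  invFun v x := v ⟨x.1, g x.1 x.2⟩
  left_inv v := by funext x; simp
  right_inv v := by funext x; simp
  continuous_toFun := by fun_prop
  continuous_invFun := by fun_prop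

@[simp] theorem perm_apply {n : Fin m → ℕ} (g : G n) (v : V n) (x : Idx n) :
    perm g v x = v ⟨x.1, (g x.1)⁻¹ x.2⟩ := rfl

theorem isPolyMap_perm {n : Fin m → ℕ} (g : G n) : IsPolyMap (perm g) :=
  ⟨fun x => MvPolynomial.X ⟨x.1, (g x.1)⁻¹ x.2⟩, fun v x => by simp⟩

/-- The action of `G` on meromorphic functions, `(g • f) v = f (g⁻¹ • v)`. -/
def actFun (c : Setting) {n : Fin m → ℕ} (g : G n) : Mero c (Idx n) →ₐ[ℂ] Mero c (Idx n) :=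
  pull c (perm g⁻¹) (isPolyMap_perm _)

/-- The skew group ring `𝒮(V)`: finite sums `∑ f_ξ φ_ξ` with `f_ξ` meromorphic (rational) and
`ξ ∈ V`, multiplied by `f φ_ξ ∘ f' φ_η = f φ_ξ(f') φ_{ξ + η}`. -/
abbrev Skew (c : Setting) (n : Fin m → ℕ) : Type :=
  SkewMonoidAlgebra (Mero c (Idx n)) (Multiplicative (V n))

/-- The element `f φ_ξ` of `𝒮(V)`. -/
def term (c : Setting) {n : Fin m → ℕ} (f : Mero c (Idx n)) (ξ : V n) : Skew c n :=
  SkewMonoidAlgebra.single (Multiplicative.ofAdd ξ) f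

/-- The coefficient of `φ_ξ` in an element of `𝒮(V)`. -/
def coef {c : Setting} {n : Fin m → ℕ} (A : Skew c n) (ξ : V n) : Mero c (Idx n) :=
  A.coeff (Multiplicative.ofAdd ξ)

/-- Permutation of coordinates, as an endomorphism of the group `V`. -/
def permHom {n : Fin m → ℕ} (g : G n) : Multiplicative (V n) →* Multiplicative (V n) where
  toFun ξ := Multiplicative.ofAdd (perm g ξ.toAdd)
  map_one' := rfl
  map_mul' _ _ := rfl

theorem actFun_smul (c : Setting) {n : Fin m → ℕ} (g : G n) (ξ : Multiplicative (V n))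
    (f : Mero c (Idx n)) : actFun c g (ξ • f) = permHom g ξ • actFun c g f := by
  obtain ⟨_, f, hf, rfl⟩ := f
  refine Subtype.ext (congrArg (fun h : V n → ℂ => (h : Germ (generic (V n)) ℂ)) ?_)
  funext x
  refine congrArg f ?_
  funext y
  simp only [translation_apply, perm_apply, Pi.sub_apply, Pi.inv_apply, inv_inv]
  refine congrArg₂ (· - ·) rfl ?_
  change _ = perm g ξ.toAdd _
  simp

/-- The action of `G` on the skew group ring: the algebra endomorphism given by
`g • (f φ_ξ) = (g • f) φ_{g • ξ}`, see `actSkew_term`. -/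
def actSkew (c : Setting) {n : Fin m → ℕ} (g : G n) : Skew c n →ₐ[ℂ] Skew c n :=
  SkewMonoidAlgebra.liftNCAlgHom
    (AlgHom.mk (SkewMonoidAlgebra.singleOneRingHom.comp (actFun c g).toRingHom) (by
      intro r
      rw [SkewMonoidAlgebra.coe_algebraMap, Function.comp_apply, ← (actFun c g).commutes r]
      rfl))
    ((SkewMonoidAlgebra.of (Mero c (Idx n)) (Multiplicative (V n))).comp (permHom g))
    (by
      intro x y
      change SkewMonoidAlgebra.single 1 (actFun c g (y • x)) *
          SkewMonoidAlgebra.single (permHom g y) 1 =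
        SkewMonoidAlgebra.single (permHom g y) 1 * SkewMonoidAlgebra.single 1 (actFun c g x)
      simp [SkewMonoidAlgebra.single_mul_single, actFun_smul])

theorem actSkew_term (c : Setting) {n : Fin m → ℕ} (g : G n) (f : Mero c (Idx n)) (ξ : V n) :
    actSkew c g (term c f ξ) = term c (actFun c g f) (perm g ξ) := by
  change SkewMonoidAlgebra.liftNC _ _ (SkewMonoidAlgebra.single _ f) = _
  rw [SkewMonoidAlgebra.liftNC_single]
  change SkewMonoidAlgebra.single 1 (actFun c g f) *
    SkewMonoidAlgebra.single (permHom g (Multiplicative.ofAdd ξ)) 1 = _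
  rw [SkewMonoidAlgebra.single_mul_single, one_mul, one_smul, mul_one]
  rfl

/-- The subalgebra `𝒮(V)^G` of `G`-invariant elements. -/
def invariants (c : Setting) (n : Fin m → ℕ) : Subalgebra ℂ (Skew c n) where
  carrier := {A | ∀ g : G n, actSkew c g A = A}
  mul_mem' := fun {A B} hA hB g => by rw [map_mul, hA g, hB g]
  add_mem' := fun {A B} hA hB g => by rw [map_add, hA g, hB g]
  algebraMap_mem' := fun r g => (actSkew c g).commutes r

/-! ### The vector space `𝔒^G` and the action of `𝒮(V)` on germs -/

/-- Families `(F_v)_{v ∈ V}` of germs (along dense open sets) of functions. -/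
abbrev GermFamily (n : Fin m → ℕ) : Type := ∀ v : V n, Germ (genericAt v) ℂ

/-- The translation `φ_ξ` of families of germs: it moves the germ `F_v` at `v` to the germ
`F_v ∘ ξ⁻¹` at `v + ξ`. -/
def translateGerms {n : Fin m → ℕ} (ξ : V n) (F : GermFamily n) : GermFamily n :=
  fun w => (F (translation ξ w)).compTendsto (translation ξ) (tendsto_genericAt _ w)

/-- The action of `G` on families of germs: it moves the germ `F_v` at `v` to the germ
`F_v ∘ g⁻¹` at `g • v`. -/
def permGerms {n : Fin m → ℕ} (g : G n) (F : GermFamily n) : GermFamily n :=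
  fun w => (F (perm g⁻¹ w)).compTendsto (perm g⁻¹) (tendsto_genericAt _ w)

/-- The action of `A = ∑ f_ξ φ_ξ ∈ 𝒮(V)` on families of germs. -/
def actGerms {c : Setting} {n : Fin m → ℕ} (A : Skew c n) (F : GermFamily n) : GermFamily n :=
  fun w => A.sum fun ξ f => f.germAt w * translateGerms ξ.toAdd F w

/-- The vector space `𝔒^G`: the `G`-invariant elements of `𝔒 = ⨁_v 𝒪_v`, equivalently the direct
sum over the `G`-orbits of the spaces of `G`-invariant families of germs on the orbit. -/
def invariantGerms (c : Setting) (n : Fin m → ℕ) : Set (GermFamily n) :=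
  {F | {v | F v ≠ 0}.Finite ∧
    (∀ v, ∃ h : V n → ℂ, IsRegularAt c h v ∧ F v = (h : Germ (genericAt v) ℂ)) ∧
    ∀ g : G n, permGerms g F = F}

/-- `A` preserves the vector space `𝔒^G`. -/
def PreservesInvariantGerms {c : Setting} {n : Fin m → ℕ} (A : Skew c n) : Prop :=
  ∀ F ∈ invariantGerms c n, actGerms A F ∈ invariantGerms c n

/-! ### Standard elements -/

/-- The vector `ξ^a_k = a δ^{k1}`. -/
def xi {n : Fin m → ℕ} [∀ k, NeZero (n k)] (k : Fin m) (a : ℂ) : V n :=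
  Pi.single (⟨k, 0⟩ : Idx n) a

/-- The standard element `∑_{g ∈ G} g • (f φ_{ξ^a_k})`. -/
def standardElement (c : Setting) {n : Fin m → ℕ} [∀ k, NeZero (n k)] (f : Mero c (Idx n))
    (k : Fin m) (a : ℂ) : Skew c n :=
  ∑ g : G n, actSkew c g (term c f (xi k a))

/-! ### Rational Galois orders -/

/-- The transposition `(i j)` in the `k`-th factor of `G`, that is, the reflection in the
hyperplane `x_{ki} = x_{kj}`. -/
def reflection {n : Fin m → ℕ} (k : Fin m) (i j : Fin (n k)) : G n :=
  Pi.mulSingle k (Equiv.swap i j)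

/-- The linear form `x_{ki} - x_{kj}`. -/
def root (c : Setting) {n : Fin m → ℕ} (k : Fin m) (i j : Fin (n k)) : Mero c (Idx n) :=
  ofPoly c (MvPolynomial.X ⟨k, i⟩ - MvPolynomial.X ⟨k, j⟩)

/-- `Δ = ∏_k ∏_{i < j} (x_{ki} - x_{kj})`. -/
def delta (c : Setting) (n : Fin m → ℕ) : Mero c (Idx n) :=
  ∏ k, ∏ ij : Fin (n k) × Fin (n k) with ij.1 < ij.2, root c k ij.1 ij.2

/-- `d_χ = ∏_H γ_H ^ {a_H}` for a character `χ` of `G`. The product is over the reflection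
hyperplanes `H = {x_{ki} = x_{kj}}`, `i < j`, the form `γ_H` is `x_{ki} - x_{kj}`, and `a_H` is
the least `a` such that `χ(σ_H) = det(σ_H)^a = (-1)^a`. -/
def dChi (c : Setting) {n : Fin m → ℕ} (χ : G n →* ℂˣ) : Mero c (Idx n) :=
  ∏ k, ∏ ij : Fin (n k) × Fin (n k) with ij.1 < ij.2,
    root c k ij.1 ij.2 ^ sInf {a : ℕ | χ (reflection k ij.1 ij.2) = (-1) ^ a}

/-- `X ∈ 𝒮(V)` is holomorphic (polynomial) in `V`: all its coefficients are. -/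
def IsHolomorphic {c : Setting} {n : Fin m → ℕ} (X : Skew c n) : Prop :=
  ∀ ξ, coef X ξ ∈ regularFunctions c (Idx n)

/-- The condition on the generators of a rational Galois order: `X` is `G`-invariant and
`d_χ X` is holomorphic for some character `χ` of `G`. -/
def IsGeneratorElement {c : Setting} {n : Fin m → ℕ} (X : Skew c n) : Prop :=
  X ∈ invariants c n ∧ ∃ χ : G n →* ℂˣ, IsHolomorphic (term c (dChi c χ) 0 * X)

/-- The algebra `H⁰(V, 𝒪^G)` of global `G`-invariant holomorphic (polynomial) functions,
viewed inside `𝒮(V)`. -/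
def invariantFunctions (c : Setting) (n : Fin m → ℕ) : Set (Skew c n) :=
  {B | ∃ f ∈ regularFunctions c (Idx n), (∀ g : G n, actFun c g f = f) ∧ B = term c f 0}

/-- `R` is a rational Galois order with the finite set `S` of generators: a
subalgebra of `𝒮(V)^G` that contains `H⁰(V, 𝒪^G)` and is generated over it by `S`, where every
element of `S` becomes holomorphic after multiplication by some `d_χ`. -/
structure IsRationalGaloisOrderWith {c : Setting} {n : Fin m → ℕ} (R : Subalgebra ℂ (Skew c n))
    (S : Set (Skew c n)) : Prop where
  le_invariants : R ≤ invariants c n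
  contains : invariantFunctions c n ⊆ R
  finite : S.Finite
  generator : ∀ X ∈ S, IsGeneratorElement X
  eq_adjoin : R = Algebra.adjoin ℂ (invariantFunctions c n ∪ S)

/-- `A` is a generator of some rational Galois order. -/
def IsGeneratorOfRationalGaloisOrder {c : Setting} {n : Fin m → ℕ} (A : Skew c n) : Prop :=
  ∃ (R : Subalgebra ℂ (Skew c n)) (S : Set (Skew c n)), IsRationalGaloisOrderWith R S ∧ A ∈ S

end Skew

end OGZ

end

/-!
Fix a shift `ξ = a δ^{kj}` with `a ≠ 0` and a point `w`, and let `J` be the set of the `i` with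
`w_{ki} = w_{kj}`. An element of `𝔒^G` supported on the `G`-orbit of `w - ξ` is moved to `w` only by
the shifts `ξ'` with `w - ξ'` in that orbit. As all shifts in `A` have at most one nonzero
coordinate, comparing the block sums of the coordinates and of their squares shows that these are
the `a δ^{ki}` with `i ∈ J` (`exists_of_sub_single_mem_orbit`).

At a point `u` of the orbit take the germ of the coefficient of `T^l` in
`∏_{i : u_{ki} = w_{kj}} (T - x_{ki})`. This family is `G`-invariant, and translation by `a δ^{ki}`
carries it to the coefficient of `T^l` in `∏_{i' ∈ J, i' ≠ i} (T - x_{ki'})`. Hence all coefficients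
of the polynomial `∑_{i ∈ J} A_{a δ^{ki}} ∏_{i' ∈ J, i' ≠ i} (T - x_{ki'})` in `T` are regular at
`w`. For `T = x_{kj}` only the term `i = j` survives, so `A_ξ ∏_{i ∈ J, i ≠ j} (x_{kj} - x_{ki})` is
regular at `w` (`germAt_coef_single_mul_mem`). This product divides `Δ`, so `A_ξ Δ` is regular at
every point. The coefficient of `φ_0` is treated with the family `1` on the orbit of `w`.

A meromorphic function that is regular at every point is entire by gluing; a rational one is a
polynomial by the Nullstellensatz, applied to the ideal of its denominators
(`mem_regularFunctions_of_germAt`). This gives the bound on the poles. As `Δ = d_χ` for the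
sign character `χ`, the element `A` generates a rational Galois order over the invariant functions.
Finally, distinct vectors `ξ^a_k` lie in distinct orbits, so under the hypotheses on `f_s` the
coefficient of `A` at `ξ^{a_s}_{i_s}` is `f_s` times the order of the stabilizer.
-/

noncomputable section

namespace OGZ

/-! ### Sections of the structure sheaf are determined locally -/

section LocalToGlobal

variable {ι : Type*} [Fintype ι]

theorem isRegularAt_eval (c : Setting) (P : MvPolynomial ι ℂ) (v : ι → ℂ) :
    IsRegularAt c (fun x => MvPolynomial.eval x P) v := by
  cases c with
  | analytic => exact analyticAt_eval P v
  | algebraic => exact ⟨P, 1, by simp, by simp⟩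

theorem IsRegularAt.add {c : Setting} {f g : (ι → ℂ) → ℂ} {v : ι → ℂ} (hf : IsRegularAt c f v)
    (hg : IsRegularAt c g v) : IsRegularAt c (f + g) v := by
  cases c with
  | analytic => exact AnalyticAt.add hf hg
  | algebraic =>
    obtain ⟨P, Q, hQ, h⟩ := hf
    obtain ⟨P', Q', hQ', h'⟩ := hg
    refine ⟨P * Q' + P' * Q, Q * Q', by simpa using ⟨hQ, hQ'⟩, ?_⟩
    filter_upwards [h, h'] with x hx hx'
    simp only [Pi.add_apply, map_add, map_mul, ← hx, ← hx']
    ring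

theorem IsRegularAt.mul {c : Setting} {f g : (ι → ℂ) → ℂ} {v : ι → ℂ} (hf : IsRegularAt c f v)
    (hg : IsRegularAt c g v) : IsRegularAt c (f * g) v := by
  cases c with
  | analytic => exact AnalyticAt.mul hf hg
  | algebraic =>
    obtain ⟨P, Q, hQ, h⟩ := hf
    obtain ⟨P', Q', hQ', h'⟩ := hg
    refine ⟨P * P', Q * Q', by simpa using ⟨hQ, hQ'⟩, ?_⟩
    filter_upwards [h, h'] with x hx hx'
    simp only [Pi.mul_apply, map_mul, ← hx, ← hx']
    ring

theorem eventually_genericAt_iff {X : Type*} [TopologicalSpace X] {v : X} {p : X → Prop} :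
    (∀ᶠ x in genericAt v, p x) ↔
      ∃ U D : Set X, IsOpen U ∧ v ∈ U ∧ IsOpen D ∧ Dense D ∧ ∀ x ∈ U ∩ D, p x := by
  constructor
  · intro h
    obtain ⟨U, hU, D, hD, h⟩ := Filter.eventually_inf.1 h
    obtain ⟨O, hO, hOo, hv⟩ := mem_nhds_iff.1 hU
    exact ⟨O, interior D, hOo, hv, isOpen_interior, hD,
      fun x hx => h x ⟨hO hx.1, interior_subset hx.2⟩⟩
  · rintro ⟨U, D, hU, hv, hD, hDd, h⟩
    refine Filter.eventually_inf.2 ⟨U, hU.mem_nhds hv, D, ?_, h⟩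
    change Dense (interior D)
    rwa [hD.interior_eq]

/-- Germs at the generic filter are determined locally. -/
theorem eventually_generic_of_genericAt {X : Type*} [TopologicalSpace X] {p : X → Prop}
    (h : ∀ v, ∀ᶠ x in genericAt v, p x) : ∀ᶠ x in generic X, p x := by
  change Dense (interior {x | p x})
  intro v
  obtain ⟨U, D, hU, hv, hD, hDd, hp⟩ := eventually_genericAt_iff.1 (h v)
  refine closure_mono (interior_maximal hp (hU.inter hD)) ?_
  exact hDd.open_subset_closure_inter hU hv

theorem eq_of_continuousAt_of_genericAt {X : Type*} [TopologicalSpace X] {f g : X → ℂ} {v : X}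
    (hf : ContinuousAt f v) (hg : ContinuousAt g v) (h : ∀ᶠ x in genericAt v, f x = g x) :
    f v = g v := by
  by_contra hne
  have hev : ∀ᶠ x in 𝓝 v, f x ≠ g x := by
    filter_upwards [(hf.sub hg).eventually_ne (sub_ne_zero.2 hne)] with x hx
    exact sub_ne_zero.1 hx
  obtain ⟨U, D, hU, hv, hD, hDd, hp⟩ := eventually_genericAt_iff.1 h
  obtain ⟨O, hO, hOo, hvO⟩ := mem_nhds_iff.1 (Filter.inter_mem hev (hU.mem_nhds hv))
  obtain ⟨x, hx, hxD⟩ := hDd.inter_open_nonempty O hOo ⟨v, hvO⟩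
  exact (hO hx).1 (hp x ⟨(hO hx).2, hxD⟩)

theorem genericAt_eventually_genericAt {X : Type*} [TopologicalSpace X] {v : X} {p : X → Prop}
    (h : ∀ᶠ x in genericAt v, p x) : ∀ᶠ y in 𝓝 v, ∀ᶠ x in genericAt y, p x := by
  obtain ⟨U, D, hU, hv, hD, hDd, hp⟩ := eventually_genericAt_iff.1 h
  filter_upwards [hU.mem_nhds hv] with y hy
  exact eventually_genericAt_iff.2 ⟨U, D, hU, hy, hD, hDd, hp⟩

theorem mvPolynomial_eq_of_eventually {P Q : MvPolynomial ι ℂ} {v : ι → ℂ}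
    (h : ∀ᶠ x in 𝓝 v, MvPolynomial.eval x P = MvPolynomial.eval x Q) : P = Q := by
  apply MvPolynomial.funext
  intro x
  have := (AnalyticOnNhd.eval_mvPolynomial (𝕜 := ℂ) P).eqOn_of_preconnected_of_eventuallyEq
    (AnalyticOnNhd.eval_mvPolynomial (𝕜 := ℂ) Q) isPreconnected_univ (Set.mem_univ v) h
  exact this (Set.mem_univ x)

theorem mvPolynomial_eq_of_genericAt {P Q : MvPolynomial ι ℂ} {v : ι → ℂ}
    (h : ∀ᶠ x in genericAt v, MvPolynomial.eval x P = MvPolynomial.eval x Q) : P = Q := by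
  apply mvPolynomial_eq_of_eventually (v := v)
  filter_upwards [genericAt_eventually_genericAt h] with y hy
  exact eq_of_continuousAt_of_genericAt (analyticAt_eval P y).continuousAt
    (analyticAt_eval Q y).continuousAt hy

/-- A nonzero polynomial is nonzero on a dense open set. -/
theorem eventually_generic_eval_ne_zero {Q : MvPolynomial ι ℂ} (hQ : Q ≠ 0) :
    ∀ᶠ x in generic (ι → ℂ), MvPolynomial.eval x Q ≠ 0 := by
  change Dense (interior {x | MvPolynomial.eval x Q ≠ 0})
  have hc : Continuous fun x => MvPolynomial.eval x Q := MvPolynomial.continuous_eval Q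
  have ho : IsOpen {x | MvPolynomial.eval x Q ≠ 0} := isOpen_ne_fun hc continuous_const
  rw [ho.interior_eq]
  intro v
  by_contra hv
  refine hQ (mvPolynomial_eq_of_eventually (v := v) ?_)
  filter_upwards [isClosed_closure.isOpen_compl.mem_nhds hv] with x hx
  by_contra hne
  exact hx (subset_closure (by simpa using hne))

/-- Germs at `v` of sections of the structure sheaf. -/
def regularGerms (c : Setting) (v : ι → ℂ) : Subsemiring (Germ (genericAt v) ℂ) where
  carrier := {φ | ∃ h, IsRegularAt c h v ∧ φ = (h : Germ (genericAt v) ℂ)}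
  mul_mem' := by
    rintro _ _ ⟨f, hf, rfl⟩ ⟨g, hg, rfl⟩
    exact ⟨f * g, hf.mul hg, rfl⟩
  add_mem' := by
    rintro _ _ ⟨f, hf, rfl⟩ ⟨g, hg, rfl⟩
    exact ⟨f + g, hf.add hg, rfl⟩
  one_mem' := ⟨_, isRegularAt_eval c 1 v, congrArg Germ.ofFun
    (funext fun x => (map_one (MvPolynomial.eval x)).symm)⟩
  zero_mem' := ⟨_, isRegularAt_eval c 0 v, congrArg Germ.ofFun
    (funext fun x => (map_zero (MvPolynomial.eval x)).symm)⟩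

theorem mem_regularFunctions_analytic {φ : Mero .analytic ι}
    (h : ∀ v, φ.germAt v ∈ regularGerms .analytic v) :
    φ ∈ regularFunctions .analytic ι := by
  obtain ⟨_, f, hf, rfl⟩ := φ
  choose H hH hfH using h
  have hfH' : ∀ v, ∀ᶠ x in genericAt v, f x = H v x := fun v => Germ.coe_eq.1 (hfH v)
  -- The value at `v` of the glued function is that of the local representative at `v`.
  have hglue : ∀ v, ∀ᶠ y in 𝓝 v, H y y = H v y := by
    intro v
    filter_upwards [genericAt_eventually_genericAt (hfH' v),
      AnalyticAt.eventually_analyticAt (hH v)] with y hy hya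
    refine eq_of_continuousAt_of_genericAt (AnalyticAt.continuousAt (hH y)) hya.continuousAt ?_
    filter_upwards [hy, hfH' y] with x hx hx'
    rw [← hx, ← hx']
  refine ⟨fun v => H v v, fun v => ?_, Germ.coe_eq.2 (eventually_generic_of_genericAt fun v => ?_)⟩
  · exact (AnalyticAt.congr (hH v) ((hglue v).mono fun y hy => hy.symm))
  · filter_upwards [hfH' v, genericAt_le_nhds v (hglue v)] with x hx hx'
    rw [hx]
    exact hx'.symm

/-- The denominators of a rational function form an ideal. If the function is regular at every
point, this ideal has no zeros, and so contains `1` by the Nullstellensatz. -/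
theorem mem_regularFunctions_algebraic {φ : Mero .algebraic ι}
    (h : ∀ v, φ.germAt v ∈ regularGerms .algebraic v) :
    φ ∈ regularFunctions .algebraic ι := by
  obtain ⟨_, f, ⟨P, Q, hQ, hf⟩, rfl⟩ := φ
  let I : Ideal (MvPolynomial ι ℂ) :=
    { carrier := {R | ∃ S, ∀ᶠ x in generic (ι → ℂ),
        f x * MvPolynomial.eval x R = MvPolynomial.eval x S}
      zero_mem' := ⟨0, by simp⟩
      add_mem' := by
        rintro R R' ⟨S, hS⟩ ⟨S', hS'⟩
        refine ⟨S + S', ?_⟩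
        filter_upwards [hS, hS'] with x hx hx'
        rw [map_add, map_add, mul_add, hx, hx']
      smul_mem' := by
        rintro T R ⟨S, hS⟩
        refine ⟨T * S, ?_⟩
        filter_upwards [hS] with x hx
        rw [smul_eq_mul, map_mul, map_mul, ← hx]
        ring }
  have hzero : MvPolynomial.zeroLocus ℂ I = ∅ := by
    rw [Set.eq_empty_iff_forall_notMem]
    intro v hv
    obtain ⟨F, ⟨S, R, hR, hF⟩, hfF⟩ := h v
    have hfF' : ∀ᶠ x in genericAt v, f x = F x := Germ.coe_eq.1 hfF
    have heq : P * R = Q * S := by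
      apply mvPolynomial_eq_of_genericAt (v := v)
      filter_upwards [hfF', genericAt_le_nhds v hF, genericAt_le_generic v hf] with x h1 h2 h3
      rw [map_mul, map_mul, ← h3, ← h2, ← h1]
      ring
    refine hR (hv R ⟨S, ?_⟩)
    filter_upwards [hf, eventually_generic_eval_ne_zero hQ] with x h1 h2
    have := congrArg (MvPolynomial.eval x) heq
    rw [map_mul, map_mul, ← h1] at this
    apply mul_left_cancel₀ h2
    rw [← this]
    ring
  have hI : (1 : MvPolynomial ι ℂ) ∈ I := by
    have := MvPolynomial.vanishingIdeal_zeroLocus_eq_radical (K := ℂ) I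
    rw [hzero, MvPolynomial.vanishingIdeal_empty] at this
    exact (Ideal.eq_top_iff_one I).1 (Ideal.radical_eq_top.1 this.symm)
  obtain ⟨S, hS⟩ := hI
  exact ⟨fun x => MvPolynomial.eval x S, ⟨S, fun _ => rfl⟩,
    Germ.coe_eq.2 (hS.mono fun x hx => by simpa using hx)⟩

/-- A meromorphic (rational) function that is regular at every point is entire (polynomial). -/
theorem mem_regularFunctions_of_germAt {c : Setting} {φ : Mero c ι}
    (h : ∀ v, φ.germAt v ∈ regularGerms c v) : φ ∈ regularFunctions c ι := by
  cases c with
  | analytic => exact mem_regularFunctions_analytic h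
  | algebraic => exact mem_regularFunctions_algebraic h

/-- The germ at `v` of a polynomial function, as a ring homomorphism. -/
def polyGerm (v : ι → ℂ) : MvPolynomial ι ℂ →+* Germ (genericAt v) ℂ :=
  (Germ.coeRingHom (genericAt v)).comp (RingHom.pi fun x => MvPolynomial.eval x)

theorem polyGerm_mem (c : Setting) (v : ι → ℂ) (P : MvPolynomial ι ℂ) :
    polyGerm v P ∈ regularGerms c v :=
  ⟨_, isRegularAt_eval c P v, rfl⟩

theorem germAt_mul {c : Setting} (φ ψ : Mero c ι) (v : ι → ℂ) :
    (φ * ψ).germAt v = φ.germAt v * ψ.germAt v := by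
  obtain ⟨_, f, hf, rfl⟩ := φ
  obtain ⟨_, g, hg, rfl⟩ := ψ
  rfl

theorem germAt_zero {c : Setting} (v : ι → ℂ) : (0 : Mero c ι).germAt v = 0 := rfl

theorem germAt_ofPoly (c : Setting) (P : MvPolynomial ι ℂ) (v : ι → ℂ) :
    (ofPoly c P).germAt v = polyGerm v P := rfl

/-- Polynomials as meromorphic (rational) functions, as a ring homomorphism. -/
def ofPolyHom (c : Setting) : MvPolynomial ι ℂ →+* Mero c ι where
  toFun := ofPoly c
  map_one' := Subtype.ext (congrArg (Germ.ofFun (l := generic (ι → ℂ)))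
    (funext fun _ => map_one (MvPolynomial.eval _)))
  map_zero' := Subtype.ext (congrArg (Germ.ofFun (l := generic (ι → ℂ)))
    (funext fun _ => map_zero (MvPolynomial.eval _)))
  map_mul' _ _ := Subtype.ext (congrArg (Germ.ofFun (l := generic (ι → ℂ)))
    (funext fun _ => map_mul (MvPolynomial.eval _) _ _))
  map_add' _ _ := Subtype.ext (congrArg (Germ.ofFun (l := generic (ι → ℂ)))
    (funext fun _ => map_add (MvPolynomial.eval _) _ _))

end LocalToGlobal

/-! ### Coefficients of standard elements -/

section Coefficients

variable {m : ℕ} {n : Fin m → ℕ}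

theorem perm_mul (g h : G n) (v : V n) : perm (g * h) v = perm g (perm h v) := by
  funext x
  simp [mul_inv_rev]

theorem perm_perm_inv (g : G n) (v : V n) : perm g (perm g⁻¹ v) = v := by
  funext x
  simp

theorem actFun_mul (c : Setting) (g h : G n) (f : Mero c (Idx n)) :
    actFun c (g * h) f = actFun c g (actFun c h f) := by
  obtain ⟨_, f, hf, rfl⟩ := f
  refine Subtype.ext (congrArg (Germ.ofFun (l := generic (V n))) (funext fun x => ?_))
  change f (perm (g * h)⁻¹ x) = f (perm h⁻¹ (perm g⁻¹ x))
  rw [mul_inv_rev, perm_mul]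

theorem actSkew_mul_term (c : Setting) (g h : G n) (f : Mero c (Idx n)) (ξ : V n) :
    actSkew c g (actSkew c h (term c f ξ)) = actSkew c (g * h) (term c f ξ) := by
  rw [actSkew_term, actSkew_term, actSkew_term, perm_mul, actFun_mul]

theorem coef_sum {c : Setting} {κ : Type*} (s : Finset κ) (B : κ → Skew c n) (ξ : V n) :
    coef (∑ t ∈ s, B t) ξ = ∑ t ∈ s, coef (B t) ξ := by
  classical
  induction s using Finset.induction_on with
  | empty => rfl
  | insert t s ht ih =>
    rw [Finset.sum_insert ht, Finset.sum_insert ht, ← ih, coef, SkewMonoidAlgebra.coeff_add]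
    rfl

open Classical in
theorem coef_term (c : Setting) (f : Mero c (Idx n)) (η ξ : V n) :
    coef (term c f η) ξ = if η = ξ then f else 0 :=
  SkewMonoidAlgebra.coeff_single_apply

theorem coef_term_zero_mul {c : Setting} (d : Mero c (Idx n)) (A : Skew c n) (ξ : V n) :
    coef (term c d 0 * A) ξ = d * coef A ξ :=
  SkewMonoidAlgebra.coeff_single_one_mul _ _ _

theorem perm_single (g : G n) (x : Idx n) (a : ℂ) :
    perm g (Pi.single x a : V n) = Pi.single (⟨x.1, g x.1 x.2⟩ : Idx n) a := by
  funext ⟨l, j⟩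
  obtain ⟨k, i⟩ := x
  simp only [perm_apply, Pi.single_apply]
  refine if_congr ?_ rfl rfl
  constructor
  · intro h
    obtain ⟨rfl, h⟩ := Sigma.mk.inj_iff.1 h
    rw [← eq_of_heq h]
    simp
  · intro h
    obtain ⟨rfl, h⟩ := Sigma.mk.inj_iff.1 h
    rw [eq_of_heq h]
    simp

variable [∀ k, NeZero (n k)]

theorem standardElement_mem_invariants (c : Setting) (f : Mero c (Idx n)) (k : Fin m) (a : ℂ) :
    standardElement c f k a ∈ invariants c n := by
  intro g
  unfold standardElement
  rw [map_sum]
  simp only [actSkew_mul_term]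
  exact Fintype.sum_equiv (Equiv.mulLeft g) _ _ fun h => rfl

open Classical in
theorem coef_standardElement (c : Setting) (f : Mero c (Idx n)) (k : Fin m) (a : ℂ) (ξ : V n) :
    coef (standardElement c f k a) ξ =
      ∑ g : G n, if perm g (xi k a) = ξ then actFun c g f else 0 := by
  unfold standardElement
  rw [coef_sum]
  refine Finset.sum_congr rfl fun g _ => ?_
  rw [actSkew_term, coef_term]

/-- The shifts that occur in a sum of standard elements have at most one nonzero coordinate. -/
theorem exists_single_of_coef_ne_zero {c : Setting} {p : ℕ} {f : Fin p → Mero c (Idx n)}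
    {i : Fin p → Fin m} {a : Fin p → ℂ} {ξ : V n}
    (h : coef (∑ s, standardElement c (f s) (i s) (a s)) ξ ≠ 0) :
    ∃ x b, ξ = Pi.single x b := by
  classical
  rw [coef_sum] at h
  obtain ⟨s, -, hs⟩ := Finset.exists_ne_zero_of_sum_ne_zero h
  rw [coef_standardElement] at hs
  obtain ⟨g, -, hg⟩ := Finset.exists_ne_zero_of_sum_ne_zero hs
  rw [ite_ne_right_iff] at hg
  exact ⟨_, _, hg.1.symm.trans (perm_single g _ _)⟩

/-- Vectors `ξ^a_k` in the same `G`-orbit are equal. -/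
theorem xi_eq_of_perm_eq {k l : Fin m} {a b : ℂ} {g : G n}
    (h : perm g (xi k a) = (xi l b : V n)) : (xi k a : V n) = xi l b := by
  unfold xi at h ⊢
  rw [perm_single] at h
  by_cases ha : a = 0
  · subst ha
    simpa using h
  · have h1 := congrFun h ⟨k, g k 0⟩
    rw [Pi.single_eq_same, Pi.single_apply] at h1
    split_ifs at h1 with hk
    · obtain ⟨rfl, -⟩ := Sigma.mk.inj_iff.1 hk
      rw [h1]
    · exact absurd h1 ha

/-- Under the hypotheses on `f s`, only the `g` in the stabilizer of `ξ = xi (i s) (a s)`, and only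
the summand `s`, contribute to the coefficient of `φ_ξ`. -/
theorem coef_sum_standardElement_xi {c : Setting} {p : ℕ} (f : Fin p → Mero c (Idx n))
    (i : Fin p → Fin m) (a : Fin p → ℂ) (s : Fin p)
    (hstab : ∀ g : G n, perm g (xi (i s) (a s)) = xi (i s) (a s) → actFun c g (f s) = f s)
    (hne : ∀ t, t ≠ s → (xi (i t) (a t) : V n) ≠ xi (i s) (a s)) :
    ∃ N : ℕ, N ≠ 0 ∧ coef (∑ t, standardElement c (f t) (i t) (a t)) (xi (i s) (a s)) =
      N • f s := by
  classical
  refine ⟨(Finset.univ.filter fun g : G n => perm g (xi (i s) (a s)) = xi (i s) (a s)).card,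
    Finset.card_ne_zero_of_mem (a := 1) ?_, ?_⟩
  · simp only [Finset.mem_filter, Finset.mem_univ, true_and]
    funext x
    simp
  rw [coef_sum, Finset.sum_eq_single s]
  · rw [coef_standardElement, ← Finset.sum_filter, Finset.sum_congr rfl, Finset.sum_const]
    exact fun g hg => hstab g (Finset.mem_filter.1 hg).2
  · intro t _ hts
    rw [coef_standardElement]
    exact Finset.sum_eq_zero fun g _ => if_neg fun h => hne t hts (xi_eq_of_perm_eq h)
  · simp

end Coefficients

/-! ### The sign character -/

section SignCharacter

variable {m : ℕ} {n : Fin m → ℕ}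

/-- The character `g ↦ ∏_k sign g_k` of `G`. -/
def signCharacter (n : Fin m → ℕ) : G n →* ℂˣ where
  toFun g := ∏ k, Units.map (Int.castRingHom ℂ : ℤ →* ℂ) (Equiv.Perm.sign (g k))
  map_one' := by simp
  map_mul' g h := by simp [Finset.prod_mul_distrib]

theorem signCharacter_reflection (k : Fin m) {i j : Fin (n k)} (hij : i ≠ j) :
    signCharacter n (reflection k i j) = -1 := by
  change ∏ l, Units.map _ (Equiv.Perm.sign (reflection k i j l)) = _
  rw [Finset.prod_eq_single k]
  · rw [reflection, Pi.mulSingle_eq_same, Equiv.Perm.sign_swap hij]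
    ext
    simp
  · intro l _ hl
    rw [reflection, Pi.mulSingle_eq_of_ne hl]
    simp
  · simp

theorem dChi_signCharacter (c : Setting) : dChi c (signCharacter n) = delta c n := by
  refine Finset.prod_congr rfl fun k _ => Finset.prod_congr rfl fun ij hij => ?_
  rw [signCharacter_reflection k (Finset.mem_filter.1 hij).2.ne]
  suffices h : sInf {a : ℕ | (-1 : ℂˣ) = (-1) ^ a} = 1 by rw [h, pow_one]
  have hmem : (1 : ℕ) ∈ {a : ℕ | (-1 : ℂˣ) = (-1) ^ a} := by simp
  refine le_antisymm (Nat.sInf_le hmem) (Nat.one_le_iff_ne_zero.2 fun h0 => ?_)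
  have h := Nat.sInf_mem ⟨1, hmem⟩
  rw [h0] at h
  have h' := congrArg Units.val h
  norm_num at h'

end SignCharacter

/-! ### Test families supported on one orbit -/

section Orbit

variable {m : ℕ} {n : Fin m → ℕ}

open Classical in
/-- If `q` is a `G`-equivariant family of polynomials, the germs `q_u` at the points `u` of one
orbit form an element of `𝔒^G`. -/
theorem orbitFamily_mem_invariantGerms (c : Setting) (v : V n)
    (q : V n → MvPolynomial (Idx n) ℂ)
    (hq : ∀ (g : G n) (u x : V n),
      MvPolynomial.eval (perm g x) (q (perm g u)) = MvPolynomial.eval x (q u)) :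
    (fun u => if ∃ g : G n, u = perm g v then polyGerm u (q u) else 0 : GermFamily n) ∈
      invariantGerms c n := by
  refine ⟨?_, ?_, ?_⟩
  · refine (Set.finite_range fun g : G n => perm g v).subset fun u hu => ?_
    obtain ⟨g, hg⟩ := (ite_ne_right_iff.1 hu).1
    exact ⟨g, hg.symm⟩
  · intro u
    change _ ∈ regularGerms c u
    dsimp only
    split_ifs
    · exact polyGerm_mem c u (q u)
    · exact zero_mem _
  · intro g
    funext u
    unfold permGerms
    by_cases hu : ∃ h : G n, u = perm h v
    · have hu' : ∃ h : G n, perm g⁻¹ u = perm h v := by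
        obtain ⟨h, rfl⟩ := hu
        exact ⟨g⁻¹ * h, (perm_mul _ _ _).symm⟩
      simp only [if_pos hu, if_pos hu']
      refine congrArg (Germ.ofFun (l := genericAt u)) (funext fun x => ?_)
      exact hq g⁻¹ u x
    · have hu' : ¬ ∃ h : G n, perm g⁻¹ u = perm h v := by
        rintro ⟨h, hh⟩
        exact hu ⟨g * h, by rw [perm_mul, ← hh, perm_perm_inv]⟩
      simp only [if_neg hu, if_neg hu']
      rfl

/-- Applying an operator that preserves `𝔒^G` to a family supported on the orbit of `v`: only the
shifts `ξ` with `w - ξ` in this orbit contribute to the germ at `w`. -/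
theorem sum_orbit_mem_regularGerms {c : Setting} {A : Skew c n} (hA : PreservesInvariantGerms A)
    (w v : V n) (q : V n → MvPolynomial (Idx n) ℂ)
    (hq : ∀ (g : G n) (u x : V n),
      MvPolynomial.eval (perm g x) (q (perm g u)) = MvPolynomial.eval x (q u))
    (T : Finset (V n)) (hT : ∀ ξ ∈ T, ∃ g : G n, w - ξ = perm g v)
    (hT' : ∀ ξ, coef A ξ ≠ 0 → (∃ g : G n, w - ξ = perm g v) → ξ ∈ T)
    (Q : V n → MvPolynomial (Idx n) ℂ)
    (hQ : ∀ ξ ∈ T, ∀ x, MvPolynomial.eval (x - ξ) (q (w - ξ)) = MvPolynomial.eval x (Q ξ)) :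
    ∑ ξ ∈ T, (coef A ξ).germAt w * polyGerm w (Q ξ) ∈ regularGerms c w := by
  classical
  have hmem := (hA _ (orbitFamily_mem_invariantGerms c v q hq)).2.1 w
  change _ ∈ regularGerms c w at hmem
  convert hmem using 1
  unfold actGerms
  rw [SkewMonoidAlgebra.sum_def, Finsupp.sum_of_support_subset _
    (Finset.subset_union_left (s₂ := T.map Multiplicative.ofAdd.toEmbedding)) _
    (fun ξ _ => by rw [germAt_zero, zero_mul])]
  rw [← Finset.sum_subset Finset.subset_union_right, Finset.sum_map]
  · refine Finset.sum_congr rfl fun ξ hξ => congrArg _ ?_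
    refine Eq.symm ((congrArg (fun φ : Germ (genericAt (translation ξ w)) ℂ =>
      φ.compTendsto (translation ξ) (tendsto_genericAt _ w)) (if_pos (hT ξ hξ))).trans ?_)
    refine congrArg (Germ.ofFun (l := genericAt w)) (funext fun x => ?_)
    exact hQ ξ hξ x
  · intro ξ _ hξ
    by_cases h : ∃ g : G n, w - ξ.toAdd = perm g v
    · have h0 : coef A ξ.toAdd = 0 := by
        by_contra h0
        exact hξ (Finset.mem_map_of_mem _ (hT' _ h0 h))
      change Mero.germAt (coef A ξ.toAdd) w * _ = 0
      rw [h0, germAt_zero, zero_mul]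
    · exact (congrArg (fun φ : Germ (genericAt (translation ξ.toAdd w)) ℂ =>
        (A.coeff ξ).germAt w * φ.compTendsto (translation ξ.toAdd) (tendsto_genericAt _ w))
        (if_neg h)).trans (mul_zero _)

theorem sum_block_perm (g : G n) (v : V n) (k : Fin m) (φ : ℂ → ℂ) :
    ∑ i, φ (perm g v ⟨k, i⟩) = ∑ i, φ (v ⟨k, i⟩) :=
  Equiv.sum_comp (g k)⁻¹ fun i => φ (v ⟨k, i⟩)

theorem sum_block_sub_single (w : V n) (k : Fin m) (i : Fin (n k)) (b : ℂ) (φ : ℂ → ℂ) :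
    ∑ i', φ ((w - Pi.single (⟨k, i⟩ : Idx n) b : V n) ⟨k, i'⟩) =
      ∑ i', φ (w ⟨k, i'⟩) + (φ (w ⟨k, i⟩ - b) - φ (w ⟨k, i⟩)) := by
  rw [← sub_eq_iff_eq_add', ← Finset.sum_sub_distrib, Finset.sum_eq_single i]
  · simp
  · intro i' _ h
    have h' : (⟨k, i'⟩ : Idx n) ≠ ⟨k, i⟩ := fun h0 => h (by simpa using h0)
    rw [Pi.sub_apply, Pi.single_eq_of_ne h', sub_zero, sub_self]
  · simp

theorem sum_block_sub_single_of_ne (w : V n) {k l : Fin m} (hkl : k ≠ l) (i : Fin (n l)) (b : ℂ)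
    (φ : ℂ → ℂ) :
    ∑ i', φ ((w - Pi.single (⟨l, i⟩ : Idx n) b : V n) ⟨k, i'⟩) = ∑ i', φ (w ⟨k, i'⟩) := by
  refine Finset.sum_congr rfl fun i' _ => ?_
  have h' : (⟨k, i'⟩ : Idx n) ≠ ⟨l, i⟩ := fun h0 => hkl (Sigma.mk.inj_iff.1 h0).1
  rw [Pi.sub_apply, Pi.single_eq_of_ne h', sub_zero]

theorem eq_zero_of_sub_single_mem_orbit {w : V n} {x : Idx n} {b : ℂ} {g : G n}
    (h : w - Pi.single x b = perm g w) : b = 0 := by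
  obtain ⟨l, i⟩ := x
  have h1 := sum_block_perm g w l id
  rw [← h, sum_block_sub_single] at h1
  simpa using h1

/-- The block sums of coordinates and of their squares are constant on orbits; they determine the
shift, and the coordinate of `w` at the shifted place. -/
theorem exists_of_sub_single_mem_orbit {w : V n} {k : Fin m} {j : Fin (n k)} {a : ℂ} (ha : a ≠ 0)
    {x : Idx n} {b : ℂ} {g : G n}
    (h : w - Pi.single x b = perm g (w - Pi.single (⟨k, j⟩ : Idx n) a)) :
    ∃ i, w ⟨k, i⟩ = w ⟨k, j⟩ ∧ (Pi.single x b : V n) = Pi.single (⟨k, i⟩ : Idx n) a := by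
  obtain ⟨l, i⟩ := x
  have h1 := (sum_block_perm g (w - Pi.single (⟨k, j⟩ : Idx n) a) k id).trans
    (sum_block_sub_single w k j a id)
  have h2 := (sum_block_perm g (w - Pi.single (⟨k, j⟩ : Idx n) a) k (· ^ 2)).trans
    (sum_block_sub_single w k j a (· ^ 2))
  rw [← h] at h1 h2
  by_cases hkl : k = l
  · subst hkl
    have h1' := h1.symm.trans (sum_block_sub_single w k i b id)
    have h2' := h2.symm.trans (sum_block_sub_single w k i b (· ^ 2))
    obtain rfl : a = b := by simpa using h1'
    refine ⟨i, mul_left_cancel₀ ha ?_, rfl⟩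
    linear_combination (1 / 2 : ℂ) * h2'
  · rw [sum_block_sub_single_of_ne w hkl] at h1
    exact absurd (by simpa using h1) ha

theorem sub_single_mem_orbit {w : V n} {k : Fin m} {i j : Fin (n k)}
    (h : w ⟨k, i⟩ = w ⟨k, j⟩) (a : ℂ) :
    w - Pi.single (⟨k, i⟩ : Idx n) a =
      perm (reflection k i j) (w - Pi.single (⟨k, j⟩ : Idx n) a) := by
  have hw : perm (reflection k i j) w = w := by
    funext ⟨l, i'⟩
    rw [perm_apply]
    by_cases hl : l = k
    · subst hl
      simp only [reflection, Pi.mulSingle_eq_same, Equiv.swap_inv]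
      rcases eq_or_ne i' i with rfl | hi
      · rw [Equiv.swap_apply_left, h]
      rcases eq_or_ne i' j with rfl | hj
      · rw [Equiv.swap_apply_right, h]
      · rw [Equiv.swap_apply_of_ne_of_ne hi hj]
    · simp [reflection, Pi.mulSingle_eq_of_ne hl]
  change _ = perm (reflection k i j) w - perm (reflection k i j) (Pi.single _ a)
  rw [hw, perm_single]
  simp [reflection]

end Orbit

/-! ### Poles of the coefficients -/

section Poles

variable {m : ℕ} {n : Fin m → ℕ}

/-- The polynomial `∏_{i ∈ S} (T - x_{ki})` in the variable `T`. -/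
def blockPoly (k : Fin m) (S : Finset (Fin (n k))) : Polynomial (MvPolynomial (Idx n) ℂ) :=
  ∏ i ∈ S, (Polynomial.X - Polynomial.C (MvPolynomial.X ⟨k, i⟩))

theorem eval_coeff_blockPoly (k : Fin m) (S : Finset (Fin (n k))) (l : ℕ) (x : V n) :
    MvPolynomial.eval x ((blockPoly k S).coeff l) =
      (∏ i ∈ S, (Polynomial.X - Polynomial.C (x ⟨k, i⟩))).coeff l := by
  rw [← Polynomial.coeff_map, blockPoly, Polynomial.map_prod]
  simp

theorem eval_blockPoly (k : Fin m) (S : Finset (Fin (n k))) (P : MvPolynomial (Idx n) ℂ) :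
    (blockPoly k S).eval P = ∏ i ∈ S, (P - MvPolynomial.X ⟨k, i⟩) := by
  simp [blockPoly, Polynomial.eval_prod]

/-- The polynomial `Δ = ∏_k ∏_{i < j} (x_{ki} - x_{kj})`. -/
def deltaPoly (n : Fin m → ℕ) : MvPolynomial (Idx n) ℂ :=
  ∏ k, ∏ ij : Fin (n k) × Fin (n k) with ij.1 < ij.2,
    (MvPolynomial.X ⟨k, ij.1⟩ - MvPolynomial.X ⟨k, ij.2⟩)

theorem ofPoly_deltaPoly (c : Setting) : ofPoly c (deltaPoly n) = delta c n := by
  change ofPolyHom c (deltaPoly n) = _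
  simp only [deltaPoly, map_prod]
  rfl

theorem prod_sub_dvd_deltaPoly (k : Fin m) (j : Fin (n k)) {S : Finset (Fin (n k))} (hj : j ∉ S) :
    ∏ i ∈ S, (MvPolynomial.X ⟨k, j⟩ - MvPolynomial.X ⟨k, i⟩) ∣ deltaPoly n := by
  let pair : Fin (n k) → Fin (n k) × Fin (n k) := fun i => (min j i, max j i)
  have hinj : Set.InjOn pair S := by
    intro i _ i' _ h
    obtain ⟨h1, h2⟩ := Prod.ext_iff.1 h
    rcases le_total j i with hi | hi <;> rcases le_total j i' with hi' | hi' <;>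
      simp only [pair, min_eq_left, min_eq_right, max_eq_left, max_eq_right, hi, hi'] at h1 h2 <;>
      simp_all
  have hsub : S.image pair ⊆ Finset.univ.filter
      fun ij : Fin (n k) × Fin (n k) => ij.1 < ij.2 := by
    intro ij hij
    obtain ⟨i, hi, rfl⟩ := Finset.mem_image.1 hij
    simp only [Finset.mem_filter, Finset.mem_univ, true_and]
    exact min_lt_max.2 fun h => hj (h ▸ hi)
  refine dvd_trans ?_ (Finset.dvd_prod_of_mem _ (Finset.mem_univ k))
  refine dvd_trans ?_ (Finset.prod_dvd_prod_of_subset _ _ _ hsub)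
  rw [Finset.prod_image hinj]
  refine Finset.prod_dvd_prod_of_dvd _ _ fun i _ => ?_
  rcases le_total j i with hi | hi
  · simp only [pair, min_eq_left hi, max_eq_right hi, dvd_refl]
  · simp only [pair, min_eq_right hi, max_eq_left hi]
    rw [← neg_sub, neg_dvd]

/-- The coefficient of `φ_0` is regular everywhere: test on the family that is `1` on the
orbit of `w`. -/
theorem germAt_coef_zero_mem {c : Setting} {A : Skew c n} (hA : PreservesInvariantGerms A)
    (hsupp : ∀ ξ, coef A ξ ≠ 0 → ∃ x b, ξ = Pi.single x b) (w : V n) :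
    (coef A 0).germAt w ∈ regularGerms c w := by
  have h := sum_orbit_mem_regularGerms hA w w (fun _ => 1) (by simp) {0}
    (by
      intro ξ hξ
      rw [Finset.mem_singleton.1 hξ]
      exact ⟨1, by funext x; simp⟩)
    (by
      rintro ξ hξ ⟨g, hg⟩
      obtain ⟨x, b, rfl⟩ := hsupp ξ hξ
      rw [eq_zero_of_sub_single_mem_orbit hg, Pi.single_zero]
      exact Finset.mem_singleton_self 0)
    (fun _ => 1) (by simp)
  simpa using h

/-- Near `w`, the poles of the coefficient of `φ_ξ`, `ξ = a δ^{kj}`, are at most simple poles along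
the hyperplanes `x_{kj} = x_{ki}` through `w`. -/
theorem germAt_coef_single_mul_mem {c : Setting} {A : Skew c n} (hA : PreservesInvariantGerms A)
    (hsupp : ∀ ξ, coef A ξ ≠ 0 → ∃ x b, ξ = Pi.single x b) (w : V n) (k : Fin m) (j : Fin (n k))
    {a : ℂ} (ha : a ≠ 0) :
    (coef A (Pi.single ⟨k, j⟩ a)).germAt w * polyGerm w
      (∏ i with w ⟨k, i⟩ = w ⟨k, j⟩ ∧ (Pi.single ⟨k, j⟩ a : V n) ⟨k, i⟩ = 0,
        (MvPolynomial.X ⟨k, j⟩ - MvPolynomial.X ⟨k, i⟩)) ∈ regularGerms c w := by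
  classical
  -- `T` is the set of the contributing shifts; `S ξ` indexes the factors of the test polynomial
  -- at `w - ξ`, which the translation by `ξ` leaves unchanged.
  let T : Finset (V n) := (Finset.univ.filter fun i => w ⟨k, i⟩ = w ⟨k, j⟩).image
    fun i => Pi.single (⟨k, i⟩ : Idx n) a
  let S : V n → Finset (Fin (n k)) := fun ξ =>
    Finset.univ.filter fun i => w ⟨k, i⟩ = w ⟨k, j⟩ ∧ ξ ⟨k, i⟩ = 0
  have hTmem : ∀ ξ ∈ T, ∃ i, w ⟨k, i⟩ = w ⟨k, j⟩ ∧ ξ = Pi.single (⟨k, i⟩ : Idx n) a := by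
    intro ξ hξ
    obtain ⟨i, hi, rfl⟩ := Finset.mem_image.1 hξ
    exact ⟨i, (Finset.mem_filter.1 hi).2, rfl⟩
  have hcoeff : ∀ l, ∑ ξ ∈ T, (coef A ξ).germAt w * polyGerm w ((blockPoly k (S ξ)).coeff l) ∈
      regularGerms c w := by
    intro l
    refine sum_orbit_mem_regularGerms hA w (w - Pi.single (⟨k, j⟩ : Idx n) a)
      (fun u => (blockPoly k (Finset.univ.filter fun i => u ⟨k, i⟩ = w ⟨k, j⟩)).coeff l)
      ?_ T ?_ ?_ _ ?_
    · intro g u x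
      rw [eval_coeff_blockPoly, eval_coeff_blockPoly, Finset.prod_filter, Finset.prod_filter]
      exact congrArg (fun P : Polynomial ℂ => P.coeff l) (Equiv.prod_comp (g k)⁻¹ fun i =>
        if u ⟨k, i⟩ = w ⟨k, j⟩ then Polynomial.X - Polynomial.C (x ⟨k, i⟩) else 1)
    · intro ξ hξ
      obtain ⟨i, hi, rfl⟩ := hTmem ξ hξ
      exact ⟨_, sub_single_mem_orbit hi a⟩
    · rintro ξ hξ ⟨g, hg⟩
      obtain ⟨x, b, rfl⟩ := hsupp ξ hξ
      obtain ⟨i, hi, h⟩ := exists_of_sub_single_mem_orbit ha hg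
      rw [h]
      exact Finset.mem_image_of_mem _ (Finset.mem_filter.2 ⟨Finset.mem_univ i, hi⟩)
    · intro ξ hξ x
      obtain ⟨i', hi', rfl⟩ := hTmem ξ hξ
      rw [eval_coeff_blockPoly, eval_coeff_blockPoly]
      have hsingle : ∀ i, i ≠ i' → (Pi.single (⟨k, i'⟩ : Idx n) a : V n) ⟨k, i⟩ = 0 :=
        by
          intro i hi
          have hne : (⟨k, i⟩ : Idx n) ≠ ⟨k, i'⟩ := fun h => hi (by simpa using h)
          exact Pi.single_eq_of_ne hne _
      refine congrArg (fun P : Polynomial ℂ => P.coeff l) (Finset.prod_congr ?_ fun i hi => ?_)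
      · ext i
        simp only [S, Finset.mem_filter, Finset.mem_univ, true_and, Pi.sub_apply]
        rcases eq_or_ne i i' with rfl | hi
        · simp [hi', ha]
        · simp [hsingle i hi]
      · rw [Pi.sub_apply, (Finset.mem_filter.1 hi).2.2, sub_zero]
  -- Substitute `x_{kj}` for the variable of `blockPoly k (S ξ)`: the value is `0` if `j ∈ S ξ`.
  have hsum : ∑ ξ ∈ T, (coef A ξ).germAt w *
      polyGerm w ((blockPoly k (S ξ)).eval (MvPolynomial.X ⟨k, j⟩)) ∈ regularGerms c w := by
    let N := (T.sup fun ξ => (blockPoly k (S ξ)).natDegree) + 1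
    have hN : ∀ ξ ∈ T, (blockPoly k (S ξ)).natDegree < N := fun ξ hξ =>
      Nat.lt_succ_of_le (Finset.le_sup (f := fun ξ => (blockPoly k (S ξ)).natDegree) hξ)
    have hmem := sum_mem (t := Finset.range N) fun l _ =>
      mul_mem (hcoeff l) (polyGerm_mem c w (MvPolynomial.X ⟨k, j⟩ ^ l))
    convert hmem using 1
    simp only [Finset.sum_mul]
    rw [Finset.sum_comm]
    refine Finset.sum_congr rfl fun ξ hξ => ?_
    rw [Polynomial.eval_eq_sum_range' (hN ξ hξ), map_sum, Finset.mul_sum]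
    exact Finset.sum_congr rfl fun l _ => by rw [map_mul, mul_assoc]
  rw [Finset.sum_eq_single (Pi.single (⟨k, j⟩ : Idx n) a)] at hsum
  · rwa [eval_blockPoly] at hsum
  · intro ξ hξ hne
    obtain ⟨i, hi, rfl⟩ := hTmem ξ hξ
    have hij : (⟨k, j⟩ : Idx n) ≠ ⟨k, i⟩ := fun h => hne (by rw [h])
    rw [eval_blockPoly, Finset.prod_eq_zero (i := j), map_zero, mul_zero]
    · simp [S, Pi.single_eq_of_ne hij]
    · exact sub_self _
  · intro h
    refine absurd ?_ h
    exact Finset.mem_image.2 ⟨j, Finset.mem_filter.2 ⟨Finset.mem_univ j, rfl⟩, rfl⟩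

theorem coef_mul_delta_mem_regularFunctions {c : Setting} {A : Skew c n}
    (hA : PreservesInvariantGerms A)
    (hsupp : ∀ ξ, coef A ξ ≠ 0 → ∃ x b, ξ = Pi.single x b) (ξ : V n) :
    coef A ξ * delta c n ∈ regularFunctions c (Idx n) := by
  refine mem_regularFunctions_of_germAt fun w => ?_
  rw [germAt_mul, ← ofPoly_deltaPoly, germAt_ofPoly]
  by_cases h0 : coef A ξ = 0
  · rw [h0, germAt_zero, zero_mul]
    exact zero_mem _
  obtain ⟨⟨k, j⟩, a, rfl⟩ := hsupp ξ h0
  rcases eq_or_ne a 0 with rfl | ha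
  · rw [Pi.single_zero]
    exact mul_mem (germAt_coef_zero_mem hA hsupp w) (polyGerm_mem c w _)
  · obtain ⟨R, hR⟩ := prod_sub_dvd_deltaPoly k j
      (S := Finset.univ.filter fun i =>
        w ⟨k, i⟩ = w ⟨k, j⟩ ∧ (Pi.single ⟨k, j⟩ a : V n) ⟨k, i⟩ = 0) (by simp [ha])
    rw [hR, map_mul, ← mul_assoc]
    exact mul_mem (germAt_coef_single_mul_mem hA hsupp w k j ha) (polyGerm_mem c w R)

end Poles

end OGZ

end

theorem mainTheorem8 {m : ℕ} (n : Fin m → ℕ) [∀ k, NeZero (n k)] (c : OGZ.Setting)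
    {p : ℕ} (f : Fin p → OGZ.Mero c (OGZ.Idx n)) (i : Fin p → Fin m) (a : Fin p → ℂ)
    (A : OGZ.Skew c n)
    (hA : A = ∑ s, OGZ.standardElement c (f s) (i s) (a s))
    (hpres : OGZ.PreservesInvariantGerms A) :
    OGZ.IsGeneratorOfRationalGaloisOrder A ∧
    (∀ ξ : OGZ.V n, OGZ.coef A ξ * OGZ.delta c n ∈ OGZ.regularFunctions c (OGZ.Idx n)) ∧
    (∀ s : Fin p,
      (∀ g : OGZ.G n, OGZ.perm g (OGZ.xi (i s) (a s)) = OGZ.xi (i s) (a s) →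
        OGZ.actFun c g (f s) = f s) →
      (∀ t, t ≠ s → (OGZ.xi (i t) (a t) : OGZ.V n) ≠ OGZ.xi (i s) (a s)) →
      f s * OGZ.delta c n ∈ OGZ.regularFunctions c (OGZ.Idx n)) := by
  have hcoef := OGZ.coef_mul_delta_mem_regularFunctions hpres fun ξ hξ =>
    OGZ.exists_single_of_coef_ne_zero (f := f) (i := i) (a := a) (hA ▸ hξ)
  have hinv : A ∈ OGZ.invariants c n := by
    rw [hA]
    exact sum_mem fun s _ => OGZ.standardElement_mem_invariants c (f s) (i s) (a s)
  refine ⟨⟨_, {A}, ⟨?_, ?_, Set.finite_singleton A, ?_, rfl⟩, rfl⟩, hcoef, ?_⟩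
  · refine Algebra.adjoin_le ?_
    rintro B (⟨f, -, hf, rfl⟩ | rfl)
    · intro g
      rw [OGZ.actSkew_term, hf g]
      rfl
    · exact hinv
  · exact fun B hB => Algebra.subset_adjoin (Or.inl hB)
  · rintro X rfl
    refine ⟨hinv, OGZ.signCharacter n, fun ξ => ?_⟩
    rw [OGZ.dChi_signCharacter, OGZ.coef_term_zero_mul, mul_comm]
    exact hcoef ξ
  · intro s hstab hne
    obtain ⟨N, hN, h⟩ := OGZ.coef_sum_standardElement_xi f i a s hstab hne
    have hs := hcoef (OGZ.xi (i s) (a s))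
    rw [hA, h] at hs
    have hN' : (N : ℂ) ≠ 0 := Nat.cast_ne_zero.2 hN
    have hfs : f s * OGZ.delta c n = (N : ℂ)⁻¹ • (N • f s * OGZ.delta c n) := by
      rw [← Nat.cast_smul_eq_nsmul ℂ, smul_mul_assoc, inv_smul_smul₀ hN']
    rw [hfs]
    exact Subalgebra.smul_mem _ hs _
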